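/- Let $d\ge 0$ be an integer, let $\Sigma=(\sigma_{i,j})$ be a real symmetric positive definite $d\times d$ matrix, and let $a_k,b_k\in[-\infty,\infty]$ with $a_k<b_k$ for $k=1,\dots,d$. For $\mu\in\mathbb R^d$ let $$\varphi_{\mu,\Sigma}(x)=\frac{1}{(2\pi)^{d/2}|\Sigma|^{1/2}}\exp\Bigl\{-\tfrac12(x-\mu)'\Sigma^{-1}(x-\mu)\Bigr\},\qquad x\in\mathbb R^d,$$ and call the probability distribution on $\mathbb R^d$ whose density is $\varphi_{\mu,\Sigma}(x)/\int_{[a,b]}\varphi_{\mu,\Sigma}$ for $x\in[a,b]$, and $0$ otherwise, the normal distribution $N(\mu,\Sigma)$ doubly truncated at $a$ and $b$, where $[a,b]=\{x\in\mathbb R^d: a_k\le x_k\le b_k \text{ for all } k\}$. Let $X$ have the centered ($\mu=0$) doubly truncated normal distribution, with density $\varphi_\alpha$. For real $x,y$ and $k\ne q$ let $F_k(x)$ be the integral of $\varphi_\alpha$ over the coordinates $x_i\in[a_i,b_i]$, $i\neq k$, with the $k$-th coordinate fixed to be $x$, and let $F_{k,q}(x,y)$ be the integral of $\varphi_\alpha$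 over the coordinates $x_i\in[a_i,b_i]$, $i\ne k,q$, with the $k$-th coordinate fixed to be $x$ and the $q$-th to be $y$. At infinite truncation points put $c\,F_k(c)=0$ for $c=\pm\infty$, and $F_{k,q}(c,e)=0$ if $c$ or $e$ is $\pm\infty$. Then all coordinates of $X$ are square integrable, the moment generating function $m(t)=E(e^{t'X})$ is finite for all $t\in\mathbb R^d$, and for all $i,j$ $$\begin{aligned}E(X_iX_j)=\frac{\partial^2 m(t)}{\partial t_j\,\partial t_i}\Big|_{t=0}={}&\sigma_{i,j}+\sum_{k=1}^d\sigma_{i,k}\,\frac{\sigma_{j,k}\bigl(a_kF_k(a_k)-b_kF_k(b_k)\bigr)}{\sigma_{k,k}}\\&+\sum_{k=1}^d\sigma_{i,k}\sum_{q\ne k}\Bigl(\sigma_{j,q}-\frac{\sigma_{k,q}\sigma_{j,k}}{\sigma_{k,k}}\Bigr)\Bigl[\bigl(F_{k,q}(a_k,a_q)-F_{k,q}(a_k,b_q)\bigr)-\bigl(F_{k,q}(b_k,a_q)-F_{k,q}(b_k,b_q)\bigr)\Bigr].\end{aligned}$$ Moreover, let $\mu\in\mathbb R^d$ and let $Y$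 have the distribution $N(\mu,\Sigma)$ doubly truncated at $a+\mu$ and $b+\mu$. Then the coordinates of $Y$ are square integrable, $Y-\mu$ has the same distribution as $X$, and the covariance is invariant under this shift of location: for all $i,j$, $$\operatorname{Cov}(Y_i,Y_j)=\operatorname{Cov}(X_i,X_j)=E(X_iX_j)-E(X_i)E(X_j).$$ -/

import Mathlib

open MeasureTheory ProbabilityTheory
open scoped Matrix

noncomputable section

namespace TruncNormal

/-- The density of the `d`-dimensional normal distribution with location `μ` and non-singular
covariance matrix `S`. -/
def normalDensity {d : ℕ} (μ : Fin d → ℝ) (S : Matrix (Fin d) (Fin d) ℝ) (x : Fin d → ℝ) : ℝ :=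
  ((2 * Real.pi) ^ ((d : ℝ) / 2) * √S.det)⁻¹ *
    Real.exp (-(1 / 2) * ((x - μ) ⬝ᵥ (S⁻¹ *ᵥ (x - μ))))

/-- The closed box of all real vectors `x` with `a i ≤ x i ≤ b i` for all `i`. The truncation points
are extended reals: `a i = ⊥` (resp. `b i = ⊤`) means no truncation from below (resp. above). -/
def box {ι : Type*} (a b : ι → EReal) : Set (ι → ℝ) :=
  {x | ∀ i, a i ≤ (x i : EReal) ∧ (x i : EReal) ≤ b i}

/-- `α = P(a ≤ X ≤ b)` for an untruncated normal vector `X` with parameters `μ` and `S`. -/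
def fraction {d : ℕ} (μ : Fin d → ℝ) (S : Matrix (Fin d) (Fin d) ℝ) (a b : Fin d → EReal) : ℝ :=
  ∫ x in box a b, normalDensity μ S x

/-- The density of the doubly truncated normal distribution: `normalDensity / α` on the box and `0`
elsewhere. -/
def truncDensity {d : ℕ} (μ : Fin d → ℝ) (S : Matrix (Fin d) (Fin d) ℝ) (a b : Fin d → EReal) :
    (Fin d → ℝ) → ℝ :=
  (box a b).indicator fun x => normalDensity μ S x / fraction μ S a b

/-- The doubly truncated normal distribution, as a measure on `ℝ^d`. -/
def truncNormal {d : ℕ} (μ : Fin d → ℝ) (S : Matrix (Fin d) (Fin d) ℝ) (a b : Fin d → EReal) :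
    Measure (Fin d → ℝ) :=
  volume.withDensity fun x => ENNReal.ofReal (truncDensity μ S a b x)

/-- The moment generating function `m(t) = E(exp(t'X))` of the centered truncated normal. -/
def momentGen {d : ℕ} (S : Matrix (Fin d) (Fin d) ℝ) (a b : Fin d → EReal) (t : Fin d → ℝ) : ℝ :=
  ∫ x, Real.exp (t ⬝ᵥ x) ∂(truncNormal 0 S a b)

/-- `F_k(x)`: the `k`-th coordinate of the centered truncated density is fixed to be `x`, and the
other coordinates are integrated over their truncation intervals. -/
def marginal {d : ℕ} (S : Matrix (Fin d) (Fin d) ℝ) (a b : Fin d → EReal) (k : Fin d) (x : ℝ) : ℝ :=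
  ∫ z in box (fun i : {i : Fin d // i ≠ k} => a i) (fun i : {i : Fin d // i ≠ k} => b i),
    truncDensity 0 S a b fun i => if h : i ≠ k then z ⟨i, h⟩ else x

/-- `F_{k,q}(x, y)` for `k ≠ q`: the coordinates `k` and `q` of the centered truncated density are
fixed to be `x` and `y`, and the other coordinates are integrated over their truncation
intervals. -/
def marginal₂ {d : ℕ} (S : Matrix (Fin d) (Fin d) ℝ) (a b : Fin d → EReal) (k q : Fin d)
    (x y : ℝ) : ℝ :=
  ∫ z in box (fun i : {i : Fin d // i ≠ k ∧ i ≠ q} => a i)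
      (fun i : {i : Fin d // i ≠ k ∧ i ≠ q} => b i),
    truncDensity 0 S a b fun i =>
      if h : i ≠ k ∧ i ≠ q then z ⟨i, h⟩ else if i = k then x else y

/-- `c F_k(c)` at a truncation point `c`, which is `0` at an infinite one. -/
def endMarginal {d : ℕ} (S : Matrix (Fin d) (Fin d) ℝ) (a b : Fin d → EReal) (k : Fin d)
    (c : EReal) : ℝ :=
  if c = ⊥ ∨ c = ⊤ then 0 else c.toReal * marginal S a b k c.toReal

/-- `F_{k,q}(c, e)` at truncation points `c` and `e`, which is `0` when one of them is infinite. -/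
def cornerMarginal {d : ℕ} (S : Matrix (Fin d) (Fin d) ℝ) (a b : Fin d → EReal) (k q : Fin d)
    (c e : EReal) : ℝ :=
  if (c = ⊥ ∨ c = ⊤) ∨ (e = ⊥ ∨ e = ⊤) then 0 else marginal₂ S a b k q c.toReal e.toReal

end TruncNormal

end

namespace TruncNormal

open Set Filter Topology

/-! Write p for the centered normal density and α for its mass on the box. The score identity ∂_k p
= -(S⁻¹x)_k p, together with x_i = Σ_k S_ik (S⁻¹x)_k, turns E(X_i X_j) into a combination of the
integrals α⁻¹ ∫ x_j (S⁻¹x)_k p over the box. Integration by parts in direction k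
(`setIntegral_coord_mul_mulVec`) leaves δ_jk, which contributes S i j to the sum, and the integrals
of x_j p over the faces x_k = a_k and x_k = b_k. On a face x_k = c, `coord_eq_regression_add` writes
x_j as (S j k / S k k) c plus a combination of the scores (S⁻¹x)_q with q ≠ k. These directions are
tangent to the face, so integrating once more (`setIntegral_face_mulVec`) produces the corner terms.

Every integrand is p times factors of at most exponential growth, hence has `GaussianDecay`. This
gives integrability on boxes, faces and lines, and makes the boundary terms at infinite truncation
points vanish. The m.g.f. is never computed, only differentiated under the integral sign. A general
location reduces to the centered case by translation invariance of Lebesgue measure. -/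

/-- A continuous function dominated by a multiple of a centered Gaussian. -/
def GaussianDecay {ι : Type*} [Fintype ι] (f : (ι → ℝ) → ℝ) : Prop :=
  Continuous f ∧ ∃ C c : ℝ, 0 < c ∧ ∀ x, |f x| ≤ C * Real.exp (-c * ∑ i, x i ^ 2)

/-! ### Closure properties of Gaussian decay. -/

section Decay

variable {ι κ : Type*} [Fintype ι]

theorem integrable_exp_neg_mul_sum_sq {c : ℝ} (hc : 0 < c) :
    Integrable fun x : ι → ℝ => Real.exp (-c * ∑ i, x i ^ 2) := by
  have h := Integrable.fintype_prod (ι := ι) (𝕜 := ℝ) (f := fun _ s => Real.exp (-c * s ^ 2))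
    (μ := fun _ => (volume : Measure ℝ)) fun _ => integrable_exp_neg_mul_sq hc
  simp only [← Real.exp_sum, ← Finset.mul_sum] at h
  exact h

theorem GaussianDecay.integrable {f : (ι → ℝ) → ℝ} (hf : GaussianDecay f) : Integrable f := by
  obtain ⟨hcont, C, c, hc, h⟩ := hf
  exact ((integrable_exp_neg_mul_sum_sq hc).const_mul C).mono' hcont.aestronglyMeasurable
    (Eventually.of_forall h)

theorem GaussianDecay.add {f g : (ι → ℝ) → ℝ} (hf : GaussianDecay f) (hg : GaussianDecay g) :
    GaussianDecay fun x => f x + g x := by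
  obtain ⟨hfc, C, c, hc, hC⟩ := hf
  obtain ⟨hgc, D, e, he, hD⟩ := hg
  refine ⟨hfc.add hgc, |C| + |D|, min c e, lt_min hc he, fun x => ?_⟩
  have hs : 0 ≤ ∑ i, x i ^ 2 := Finset.sum_nonneg fun i _ => sq_nonneg _
  have h1 : Real.exp (-c * ∑ i, x i ^ 2) ≤ Real.exp (-min c e * ∑ i, x i ^ 2) :=
    Real.exp_le_exp.2 (mul_le_mul_of_nonneg_right (neg_le_neg (min_le_left _ _)) hs)
  have h2 : Real.exp (-e * ∑ i, x i ^ 2) ≤ Real.exp (-min c e * ∑ i, x i ^ 2) :=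
    Real.exp_le_exp.2 (mul_le_mul_of_nonneg_right (neg_le_neg (min_le_right _ _)) hs)
  calc |f x + g x| ≤ |f x| + |g x| := abs_add_le _ _
    _ ≤ C * Real.exp (-c * ∑ i, x i ^ 2) + D * Real.exp (-e * ∑ i, x i ^ 2) :=
        add_le_add (hC x) (hD x)
    _ ≤ |C| * Real.exp (-c * ∑ i, x i ^ 2) + |D| * Real.exp (-e * ∑ i, x i ^ 2) := by
        gcongr <;> exact le_abs_self _
    _ ≤ |C| * Real.exp (-min c e * ∑ i, x i ^ 2) + |D| * Real.exp (-min c e * ∑ i, x i ^ 2) := by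
        gcongr
    _ = _ := by ring

theorem GaussianDecay.const_mul {f : (ι → ℝ) → ℝ} (hf : GaussianDecay f) (r : ℝ) :
    GaussianDecay fun x => r * f x := by
  obtain ⟨hfc, C, c, hc, hC⟩ := hf
  refine ⟨hfc.const_mul r, |r| * C, c, hc, fun x => ?_⟩
  rw [abs_mul, mul_assoc]
  exact mul_le_mul_of_nonneg_left (hC x) (abs_nonneg r)

theorem GaussianDecay.sub {f g : (ι → ℝ) → ℝ} (hf : GaussianDecay f) (hg : GaussianDecay g) :
    GaussianDecay fun x => f x - g x := by
  simpa [sub_eq_add_neg] using hf.add (hg.const_mul (-1))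

theorem GaussianDecay.zero : GaussianDecay fun _ : ι → ℝ => 0 :=
  ⟨continuous_const, 0, 1, one_pos, fun x => by simp⟩

theorem GaussianDecay.sum {f : κ → (ι → ℝ) → ℝ} (hf : ∀ k, GaussianDecay (f k)) (s : Finset κ) :
    GaussianDecay fun x => ∑ k ∈ s, f k x := by
  classical
  induction s using Finset.induction_on with
  | empty => simpa using GaussianDecay.zero
  | insert a s ha ih => simpa [Finset.sum_insert ha] using (hf a).add ih

theorem GaussianDecay.of_abs_le {f g : (ι → ℝ) → ℝ} (hg : GaussianDecay g) (hf : Continuous f)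
    (h : ∀ x, |f x| ≤ g x) : GaussianDecay f := by
  obtain ⟨-, C, c, hc, hC⟩ := hg
  exact ⟨hf, C, c, hc, fun x => (h x).trans ((le_abs_self _).trans (hC x))⟩

theorem GaussianDecay.abs {f : (ι → ℝ) → ℝ} (hf : GaussianDecay f) :
    GaussianDecay fun x => |f x| := by
  obtain ⟨hfc, C, c, hc, hC⟩ := hf
  exact ⟨hfc.abs, C, c, hc, fun x => by simpa using hC x⟩

/-- Completing the square gives t_i x_i ≤ t_i²/(2c) + (c/2) x_i²: half of the decay rate pays for
the exponential. -/
theorem GaussianDecay.exp_mul {f : (ι → ℝ) → ℝ} (hf : GaussianDecay f) (t : ι → ℝ) :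
    GaussianDecay fun x => Real.exp (t ⬝ᵥ x) * f x := by
  obtain ⟨hfc, C, c, hc, hC⟩ := hf
  refine ⟨by unfold dotProduct; fun_prop, Real.exp (∑ i, t i ^ 2 / (2 * c)) * C, c / 2,
    half_pos hc, fun x => ?_⟩
  have hC0 : 0 ≤ C := by
    by_contra! hneg
    exact absurd ((abs_nonneg (f x)).trans (hC x))
      (not_le.2 (mul_neg_of_neg_of_pos hneg (Real.exp_pos _)))
  have key : t ⬝ᵥ x + -c * ∑ i, x i ^ 2 ≤
      ∑ i, t i ^ 2 / (2 * c) + -(c / 2) * ∑ i, x i ^ 2 := by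
    simp only [dotProduct, Finset.mul_sum, ← Finset.sum_add_distrib]
    refine Finset.sum_le_sum fun i _ => ?_
    have h : t i ^ 2 / (2 * c) - t i * x i + c / 2 * x i ^ 2 = (t i - c * x i) ^ 2 / (2 * c) := by
      field_simp
      ring
    have h' : 0 ≤ (t i - c * x i) ^ 2 / (2 * c) := by positivity
    linarith
  rw [abs_mul, Real.abs_exp]
  calc Real.exp (t ⬝ᵥ x) * |f x|
      ≤ Real.exp (t ⬝ᵥ x) * (C * Real.exp (-c * ∑ i, x i ^ 2)) := by gcongr; exact hC x
    _ = C * Real.exp (t ⬝ᵥ x + -c * ∑ i, x i ^ 2) := by rw [Real.exp_add]; ring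
    _ ≤ C * Real.exp (∑ i, t i ^ 2 / (2 * c) + -(c / 2) * ∑ i, x i ^ 2) := by gcongr
    _ = _ := by rw [Real.exp_add]; ring

theorem GaussianDecay.exp_coord_mul [DecidableEq ι] {f : (ι → ℝ) → ℝ} (hf : GaussianDecay f)
    (i : ι) (s : ℝ) : GaussianDecay fun x => Real.exp (s * x i) * f x := by
  simpa [single_dotProduct] using hf.exp_mul (Pi.single i s)

theorem GaussianDecay.exp_abs_coord_mul {f : (ι → ℝ) → ℝ} (hf : GaussianDecay f) (i : ι) (s : ℝ) :
    GaussianDecay fun x => Real.exp (s * |x i|) * f x := by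
  classical
  refine ((hf.exp_coord_mul i s).abs.add (hf.exp_coord_mul i (-s)).abs).of_abs_le
    (by have := hf.1; fun_prop) fun x => ?_
  simp only [abs_mul, Real.abs_exp]
  rcases abs_cases (x i) with ⟨h, -⟩ | ⟨h, -⟩ <;> rw [h]
  · exact le_add_of_nonneg_right (by positivity)
  · rw [mul_neg, ← neg_mul]
    exact le_add_of_nonneg_left (by positivity)

/-- Polynomial factors reduce to exponential ones through |x_i| ≤ exp |x_i|. -/
theorem GaussianDecay.coord_mul {f : (ι → ℝ) → ℝ} (hf : GaussianDecay f) (i : ι) :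
    GaussianDecay fun x => x i * f x := by
  refine ((hf.exp_abs_coord_mul i 1).abs).of_abs_le (by have := hf.1; fun_prop) fun x => ?_
  simp only [abs_mul, Real.abs_exp, one_mul]
  gcongr
  linarith [Real.add_one_le_exp |x i|]

theorem GaussianDecay.mulVec_mul {f : (ι → ℝ) → ℝ} (hf : GaussianDecay f) (M : Matrix κ ι ℝ)
    (k : κ) : GaussianDecay fun x => (M *ᵥ x) k * f x := by
  simpa [Matrix.mulVec, dotProduct, Finset.sum_mul, mul_assoc] using
    GaussianDecay.sum (fun i => (hf.coord_mul i).const_mul (M k i)) Finset.univ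

end Decay

/-! ### Splitting off one coordinate, and Fubini on a box. -/

/-- The point whose `k`-th coordinate is `s` and whose other coordinates are given by `z`. -/
def insertCoord {ι : Type*} [DecidableEq ι] (k : ι) (s : ℝ) (z : {i // i ≠ k} → ℝ) : ι → ℝ :=
  fun i => if h : i ≠ k then z ⟨i, h⟩ else s

section Insert

variable {ι : Type*} [DecidableEq ι] (k : ι)

@[simp] theorem insertCoord_self (s : ℝ) (z : {i // i ≠ k} → ℝ) : insertCoord k s z k = s := by
  simp [insertCoord]

theorem insertCoord_of_ne {i : ι} (h : i ≠ k) (s : ℝ) (z : {i // i ≠ k} → ℝ) :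
    insertCoord k s z i = z ⟨i, h⟩ := by
  simp [insertCoord, h]

theorem continuous_insertCoord :
    Continuous fun p : ({i // i ≠ k} → ℝ) × ℝ => insertCoord k p.2 p.1 := by
  refine continuous_pi fun i => ?_
  by_cases h : i ≠ k
  · simp only [insertCoord_of_ne k h]; fun_prop
  · obtain rfl := not_ne_iff.1 h
    simp only [insertCoord_self]; fun_prop

theorem insertCoord_mem_box (a b : ι → EReal) (s : ℝ) (z : {i // i ≠ k} → ℝ) :
    insertCoord k s z ∈ box a b ↔
      z ∈ box (fun i : {i // i ≠ k} => a i) (fun i : {i // i ≠ k} => b i) ∧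
        (a k ≤ s ∧ (s : EReal) ≤ b k) := by
  constructor
  · intro h
    refine ⟨fun i => ?_, ?_⟩
    · simpa [insertCoord_of_ne k i.2] using h i
    · simpa using h k
  · rintro ⟨hz, hs⟩ i
    by_cases h : i ≠ k
    · simpa [insertCoord_of_ne k h] using hz ⟨i, h⟩
    · obtain rfl := not_ne_iff.1 h
      simpa using hs

theorem measurableSet_box {ι : Type*} [Countable ι] (a b : ι → EReal) :
    MeasurableSet (box a b) := by
  have : box a b = ⋂ i, {x : ι → ℝ | a i ≤ (x i : EReal) ∧ (x i : EReal) ≤ b i} := by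
    ext x; simp [box]
  rw [this]
  refine MeasurableSet.iInter fun i => ?_
  have hm : Measurable fun x : ι → ℝ => (x i : EReal) :=
    measurable_coe_real_ereal.comp (measurable_pi_apply i)
  exact (measurableSet_le measurable_const hm).inter (measurableSet_le hm measurable_const)

variable [Fintype ι]

theorem sum_sq_insertCoord (s : ℝ) (z : {i // i ≠ k} → ℝ) :
    ∑ i, insertCoord k s z i ^ 2 = s ^ 2 + ∑ i, z i ^ 2 := by
  rw [Fintype.sum_eq_add_sum_subtype_ne _ k]
  rw [insertCoord_self]
  exact congrArg _ (Finset.sum_congr rfl fun i _ => by rw [insertCoord_of_ne k i.2])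

/-- The frozen coordinate only contributes the constant exp(-c s²), so decay passes to faces; this
lets the integration by parts be repeated there. -/
theorem GaussianDecay.insertCoord {f : (ι → ℝ) → ℝ} (hf : GaussianDecay f) (s : ℝ) :
    GaussianDecay fun z => f (insertCoord k s z) := by
  obtain ⟨hfc, C, c, hc, hC⟩ := hf
  refine ⟨hfc.comp ((continuous_insertCoord k).comp (Continuous.prodMk_left s)),
    C * Real.exp (-c * s ^ 2), c, hc, fun z => ?_⟩
  rw [mul_assoc, ← Real.exp_add, ← mul_add, ← sum_sq_insertCoord]
  exact hC _

theorem GaussianDecay.integrable_line {f : (ι → ℝ) → ℝ} (hf : GaussianDecay f)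
    (z : {i // i ≠ k} → ℝ) : Integrable fun s => f (TruncNormal.insertCoord k s z) := by
  obtain ⟨hfc, C, c, hc, hC⟩ := hf
  refine ((integrable_exp_neg_mul_sq hc).const_mul (C * Real.exp (-c * ∑ i, z i ^ 2))).mono'
    (hfc.comp ((continuous_insertCoord k).comp (Continuous.prodMk_right z))).aestronglyMeasurable
    (Eventually.of_forall fun s => ?_)
  rw [mul_assoc, ← Real.exp_add, ← mul_add, add_comm, ← sum_sq_insertCoord]
  exact hC _

theorem exists_measurableEquiv_insertCoord :
    ∃ e : (({i // i ≠ k} → ℝ) × ℝ) ≃ᵐ (ι → ℝ),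
      (∀ p, e p = insertCoord k p.2 p.1) ∧ MeasurePreserving e := by
  -- The complementary index type is the single point k, so functions on it are real numbers.
  have : Unique {i // ¬ i ≠ k} := ⟨⟨⟨k, by simp⟩⟩, fun i => Subtype.ext (not_ne_iff.1 i.2)⟩
  refine ⟨((MeasurableEquiv.refl _).prodCongr (MeasurableEquiv.funUnique _ ℝ).symm).trans
    (MeasurableEquiv.piEquivPiSubtypeProd (fun _ => ℝ) (fun i => i ≠ k)).symm, fun p => rfl, ?_⟩
  have hu : MeasurePreserving (MeasurableEquiv.funUnique {i // ¬ i ≠ k} ℝ).symm := by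
    convert! (volume_preserving_funUnique {i // ¬ i ≠ k} ℝ).symm _
  have h : MeasurePreserving ((MeasurableEquiv.refl ({i // i ≠ k} → ℝ)).prodCongr
      (MeasurableEquiv.funUnique {i // ¬ i ≠ k} ℝ).symm) :=
    (MeasurePreserving.id volume).prod hu
  exact h.trans ((volume_preserving_piEquivPiSubtypeProd (fun _ : ι => ℝ) (fun i => i ≠ k)).symm _)

theorem setIntegral_box_eq_iterated (a b : ι → EReal) {f : (ι → ℝ) → ℝ} (hf : Integrable f) :
    ∫ x in box a b, f x =
      ∫ z in box (fun i : {i // i ≠ k} => a i) (fun i : {i // i ≠ k} => b i),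
        ∫ s in {s : ℝ | a k ≤ s ∧ (s : EReal) ≤ b k}, f (insertCoord k s z) := by
  obtain ⟨e, he, hmp⟩ := exists_measurableEquiv_insertCoord k
  have hpre : e ⁻¹' box a b = box (fun i : {i // i ≠ k} => a i) (fun i : {i // i ≠ k} => b i) ×ˢ
      {s : ℝ | a k ≤ s ∧ (s : EReal) ≤ b k} := by
    ext p
    simp only [mem_preimage, he, insertCoord_mem_box, mem_prod, mem_ofPred_eq]
  rw [← hmp.setIntegral_preimage_emb e.measurableEmbedding, hpre, Measure.volume_eq_prod,
    setIntegral_prod]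
  · simp only [he]
  · exact ((hmp.integrable_comp_emb e.measurableEmbedding).2 hf).integrableOn

end Insert

/-! ### Boundary terms with possibly infinite endpoints. -/

/-- The value of `f` at a finite extended real, and `0` at an infinite one. -/
noncomputable def endValue (f : ℝ → ℝ) (c : EReal) : ℝ :=
  if c = ⊥ ∨ c = ⊤ then 0 else f c.toReal

/-- Integrability of both f and f' forces f → 0 at ±∞, so the value 0 that `endValue` assigns to an
infinite endpoint is the actual limit. -/
theorem integral_erealInterval_of_hasDerivAt {f f' : ℝ → ℝ} {a b : EReal} (hab : a < b)
    (hderiv : ∀ s, HasDerivAt f (f' s) s) (hf : Integrable f) (hf' : Integrable f') :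
    ∫ s in {s : ℝ | a ≤ s ∧ (s : EReal) ≤ b}, f' s = endValue f b - endValue f a := by
  have hbot : Tendsto f atBot (𝓝 0) := tendsto_zero_of_hasDerivAt_of_integrableOn_Iic (a := 0)
    (fun x _ => hderiv x) hf'.integrableOn hf.integrableOn
  have htop : Tendsto f atTop (𝓝 0) := tendsto_zero_of_hasDerivAt_of_integrableOn_Ioi (a := 0)
    (fun x _ => hderiv x) hf'.integrableOn hf.integrableOn
  induction a with
  | top => exact absurd hab not_top_lt
  | bot =>
    induction b with
    | bot => exact absurd hab (lt_irrefl _)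
    | top => simp [endValue, integral_of_hasDerivAt_of_tendsto hderiv hf' hbot htop]
    | coe b =>
      have : {s : ℝ | (⊥ : EReal) ≤ s ∧ (s : EReal) ≤ b} = Iic b := by ext; simp
      rw [this, integral_Iic_of_hasDerivAt_of_tendsto' (fun x _ => hderiv x) hf'.integrableOn hbot]
      simp [endValue]
  | coe a =>
    induction b with
    | bot => exact absurd hab not_lt_bot
    | top =>
      have : {s : ℝ | (a : EReal) ≤ s ∧ (s : EReal) ≤ ⊤} = Ici a := by ext; simp
      rw [this, integral_Ici_eq_integral_Ioi,
        integral_Ioi_of_hasDerivAt_of_tendsto' (fun x _ => hderiv x) hf'.integrableOn htop]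
      simp [endValue]
    | coe b =>
      have : {s : ℝ | (a : EReal) ≤ s ∧ (s : EReal) ≤ b} = Icc a b := by ext; simp
      rw [this, integral_Icc_eq_integral_Ioc,
        ← intervalIntegral.integral_of_le (EReal.coe_lt_coe_iff.1 hab).le,
        intervalIntegral.integral_eq_sub_of_hasDerivAt (fun x _ => hderiv x)
          hf'.intervalIntegrable]
      simp [endValue]

/-- The divergence theorem on a box for a field in the direction of the `k`-th coordinate. -/
theorem setIntegral_box_partialDeriv {ι : Type*} [Fintype ι] [DecidableEq ι] (k : ι)
    {a b : ι → EReal} (hab : a k < b k) {g g' : (ι → ℝ) → ℝ}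
    (hderiv : ∀ z s, HasDerivAt (fun s => g (insertCoord k s z)) (g' (insertCoord k s z)) s)
    (hg : GaussianDecay g) (hg' : GaussianDecay g') :
    ∫ x in box a b, g' x =
      endValue (fun c => ∫ z in box (fun i : {i // i ≠ k} => a i) (fun i : {i // i ≠ k} => b i),
        g (insertCoord k c z)) (b k) -
      endValue (fun c => ∫ z in box (fun i : {i // i ≠ k} => a i) (fun i : {i // i ≠ k} => b i),
        g (insertCoord k c z)) (a k) := by
  -- Taking the end value commutes with integrating over the face: at an infinite c both sides are
  -- 0.
  have hend : ∀ c : EReal,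
      IntegrableOn (fun z => endValue (fun s => g (insertCoord k s z)) c)
          (box (fun i : {i // i ≠ k} => a i) (fun i : {i // i ≠ k} => b i)) ∧
      ∫ z in box (fun i : {i // i ≠ k} => a i) (fun i : {i // i ≠ k} => b i),
          endValue (fun s => g (insertCoord k s z)) c =
        endValue (fun s => ∫ z in box (fun i : {i // i ≠ k} => a i) (fun i : {i // i ≠ k} => b i),
          g (insertCoord k s z)) c := by
    intro c
    unfold endValue
    split_ifs
    · simp
    · exact ⟨(hg.insertCoord k _).integrable.integrableOn, rfl⟩
  rw [setIntegral_box_eq_iterated k a b hg'.integrable, ← (hend _).2, ← (hend _).2,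
    ← integral_sub (hend _).1 (hend _).1]
  congr 1
  ext z
  exact integral_erealInterval_of_hasDerivAt hab (hderiv z) (hg.integrable_line k z)
    (hg'.integrable_line k z)

/-! ### Differentiation under the integral sign and coercivity of the quadratic form. -/

/-- Differentiation of an exponential integral along a coordinate direction. -/
theorem hasDerivAt_integral_mul_exp {Ω : Type*} [MeasurableSpace Ω] {P : Measure Ω} {f X : Ω → ℝ}
    (hf : AEStronglyMeasurable f P) (hX : AEStronglyMeasurable X P)
    (hint : Integrable f P) (hbound : Integrable (fun ω => Real.exp (2 * |X ω|) * |f ω|) P) :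
    HasDerivAt (fun s : ℝ => ∫ ω, f ω * Real.exp (s * X ω) ∂P) (∫ ω, f ω * X ω ∂P) 0 := by
  have h := hasDerivAt_integral_of_dominated_loc_of_deriv_le (μ := P) (𝕜 := ℝ) (x₀ := 0)
    (F := fun s ω => f ω * Real.exp (s * X ω))
    (F' := fun s ω => f ω * (Real.exp (s * X ω) * X ω))
    (bound := fun ω => Real.exp (2 * |X ω|) * |f ω|) (Metric.ball_mem_nhds 0 one_pos)
    (Eventually.of_forall fun s => hf.mul
      (Real.continuous_exp.comp_aestronglyMeasurable (hX.const_mul s)))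
    (by simpa using hint) (by simp only [zero_mul, Real.exp_zero, one_mul]; exact hf.mul hX)
    (Eventually.of_forall fun ω s hs => ?_) hbound
    (Eventually.of_forall fun ω s _ => ?_)
  · simpa using h.2
  · rw [Real.norm_eq_abs, abs_mul, abs_mul, Real.abs_exp, mul_comm]
    gcongr
    rw [mem_ball_zero_iff, Real.norm_eq_abs] at hs
    have h1 : s * X ω ≤ |X ω| := by
      calc s * X ω ≤ |s * X ω| := le_abs_self _
        _ = |s| * |X ω| := abs_mul _ _
        _ ≤ 1 * |X ω| := by gcongr
        _ = |X ω| := one_mul _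
    -- One factor exp |X| bounds exp(sX) for |s| < 1, a second one absorbs the X brought down by the
    -- derivative; hence the 2 in the bound.
    have h2 : |X ω| ≤ Real.exp |X ω| := by linarith [Real.add_one_le_exp |X ω|]
    calc Real.exp (s * X ω) * |X ω| ≤ Real.exp |X ω| * Real.exp |X ω| := by gcongr
      _ = Real.exp (2 * |X ω|) := by rw [← Real.exp_add]; ring_nf
  · refine HasDerivAt.const_mul _ ?_
    simpa using ((hasDerivAt_id s).mul_const (X ω)).exp

/-- By compactness the form has a positive minimum m on the unit sphere of the sup norm, and
homogeneity spreads it to all x. Comparing norms by Σ x_i² ≤ card ι · ‖x‖² costs the factor card ι.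
The sphere is empty when ι is. -/
theorem exists_pos_mul_sum_sq_le {ι : Type*} [Fintype ι] [DecidableEq ι] {M : Matrix ι ι ℝ}
    (hM : M.PosDef) : ∃ c : ℝ, 0 < c ∧ ∀ x : ι → ℝ, c * ∑ i, x i ^ 2 ≤ x ⬝ᵥ (M *ᵥ x) := by
  have hpos : ∀ x : ι → ℝ, x ≠ 0 → 0 < x ⬝ᵥ (M *ᵥ x) := fun x hx => by
    simpa using hM.dotProduct_mulVec_pos hx
  rcases isEmpty_or_nonempty ι with hι | hι
  · exact ⟨1, one_pos, fun x => by simp⟩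
  have hcont : Continuous fun x : ι → ℝ => x ⬝ᵥ (M *ᵥ x) := by
    simp only [dotProduct, Matrix.mulVec]
    fun_prop
  obtain ⟨y, hy, hmin⟩ := (isCompact_sphere (0 : ι → ℝ) 1).exists_isMinOn
    (NormedSpace.sphere_nonempty.2 zero_le_one) hcont.continuousOn
  have hy0 : y ≠ 0 := by
    rintro rfl
    simp at hy
  set m := y ⬝ᵥ (M *ᵥ y) with hm
  have hm0 : 0 < m := hpos y hy0
  have hcard : (0 : ℝ) < Fintype.card ι := by exact_mod_cast Fintype.card_pos
  refine ⟨m / Fintype.card ι, div_pos hm0 hcard, fun x => ?_⟩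
  have hsum : ∑ i, x i ^ 2 ≤ Fintype.card ι * ‖x‖ ^ 2 := by
    rw [← nsmul_eq_mul]
    refine Finset.sum_le_card_nsmul _ _ _ fun i _ => ?_
    rw [← sq_abs, ← Real.norm_eq_abs]
    gcongr
    exact norm_le_pi_norm x i
  have hquad : m * ‖x‖ ^ 2 ≤ x ⬝ᵥ (M *ᵥ x) := by
    rcases eq_or_ne x 0 with rfl | hx
    · simp
    have hn : 0 < ‖x‖ := norm_pos_iff.2 hx
    have h := hmin (a := ‖x‖⁻¹ • x) (by simp [norm_smul, hn.ne'])
    simp only [Matrix.mulVec_smul, dotProduct_smul, smul_dotProduct, smul_eq_mul,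
      mem_ofPred_eq, ← hm] at h
    have h' := mul_le_mul_of_nonneg_right h (sq_nonneg ‖x‖)
    refine h'.trans_eq ?_
    field_simp
  calc m / Fintype.card ι * ∑ i, x i ^ 2 ≤ m / Fintype.card ι * (Fintype.card ι * ‖x‖ ^ 2) := by
        gcongr
    _ = m * ‖x‖ ^ 2 := by field_simp
    _ ≤ _ := hquad

/-! ### The normal density and the truncated law. -/

variable {d : ℕ} {S : Matrix (Fin d) (Fin d) ℝ} {a b : Fin d → EReal}

theorem gaussianDecay_normalDensity (hS : S.PosDef) : GaussianDecay (normalDensity 0 S) := by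
  obtain ⟨c, hc, h⟩ := exists_pos_mul_sum_sq_le hS.inv
  refine ⟨?_, ((2 * Real.pi) ^ ((d : ℝ) / 2) * √S.det)⁻¹, c / 2, half_pos hc, fun x => ?_⟩
  · unfold normalDensity dotProduct Matrix.mulVec dotProduct
    fun_prop
  · rw [normalDensity, abs_of_nonneg (by positivity), sub_zero]
    refine mul_le_mul_of_nonneg_left (Real.exp_le_exp.2 ?_) (by positivity)
    linarith [h x]

theorem normalDensity_pos (hS : S.PosDef) (μ x : Fin d → ℝ) : 0 < normalDensity μ S x := by
  have := hS.det_pos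
  unfold normalDensity
  positivity

/-- The score identity, using symmetry of S⁻¹. Allowing any curve with velocity e_k makes it usable
both in the box and inside a face. -/
theorem hasDerivAt_normalDensity_line (hS : S.PosDef) {x : ℝ → Fin d → ℝ} {k : Fin d} {s : ℝ}
    (hx : HasDerivAt x (Pi.single k 1) s) :
    HasDerivAt (fun s => normalDensity 0 S (x s))
      (-((S⁻¹ *ᵥ x s) k * normalDensity 0 S (x s))) s := by
  have hxi := hasDerivAt_pi.1 hx
  have hM : ∀ i, HasDerivAt (fun s => (S⁻¹ *ᵥ x s) i) (S⁻¹ i k) s := fun i => by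
    have h := HasDerivAt.fun_sum fun j (_ : j ∈ Finset.univ) => (hxi j).const_mul (S⁻¹ i j)
    simpa [Matrix.mulVec, dotProduct, Pi.single_apply] using h
  have hsymm : ∀ i, S⁻¹ i k = S⁻¹ k i := fun i => by
    simpa using hS.inv.isHermitian.apply k i
  have hQ : HasDerivAt (fun s => x s ⬝ᵥ (S⁻¹ *ᵥ x s)) (2 * (S⁻¹ *ᵥ x s) k) s := by
    have h := HasDerivAt.fun_sum fun i (_ : i ∈ Finset.univ) => (hxi i).mul (hM i)
    refine h.congr_deriv ?_
    rw [Finset.sum_add_distrib, two_mul]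
    congr 1
    · simp [Pi.single_apply]
    · simp only [hsymm, Matrix.mulVec, dotProduct]
      exact Finset.sum_congr rfl fun i _ => mul_comm _ _
  simp only [normalDensity, sub_zero]
  refine (((hQ.const_mul (-(1 / 2))).exp).const_mul _).congr_deriv ?_
  ring

/-- Choosing reals c_k < e_k strictly between a_k and b_k gives the box positive volume, which is
what makes α > 0. -/
theorem nonempty_open_subset_box (hab : ∀ k, a k < b k) :
    ∃ U ⊆ box a b, IsOpen U ∧ U.Nonempty := by
  choose c hc hcb using fun k => EReal.lt_iff_exists_real_btwn.1 (hab k)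
  choose e he heb using fun k => EReal.lt_iff_exists_real_btwn.1 (hcb k)
  refine ⟨univ.pi fun k => Ioo (c k) (e k), fun x hx k => ?_,
    isOpen_set_pi finite_univ fun k _ => isOpen_Ioo,
    univ_pi_nonempty_iff.2 fun k => nonempty_Ioo.2 (EReal.coe_lt_coe_iff.1 (he k))⟩
  have h := hx k (mem_univ k)
  exact ⟨(hc k).le.trans (EReal.coe_le_coe_iff.2 h.1.le),
    (EReal.coe_le_coe_iff.2 h.2.le).trans (heb k).le⟩

theorem fraction_pos (hS : S.PosDef) (hab : ∀ k, a k < b k) : 0 < fraction 0 S a b := by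
  obtain ⟨U, hU, hUo, hUn⟩ := nonempty_open_subset_box hab
  have hsupp : Function.support (normalDensity 0 S) = univ := by
    ext x
    simp [(normalDensity_pos hS 0 x).ne']
  rw [fraction, setIntegral_pos_iff_support_of_nonneg_ae
    (Eventually.of_forall fun x => (normalDensity_pos hS 0 x).le)
    (gaussianDecay_normalDensity hS).integrable.integrableOn, hsupp, univ_inter]
  exact (hUo.measure_pos volume hUn).trans_le (measure_mono hU)

theorem truncDensity_of_mem {x : Fin d → ℝ} (hx : x ∈ box a b) :
    truncDensity 0 S a b x = (fraction 0 S a b)⁻¹ * normalDensity 0 S x := by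
  rw [truncDensity, indicator_of_mem hx, div_eq_inv_mul]

theorem truncDensity_nonneg (hS : S.PosDef) (hab : ∀ k, a k < b k) (x : Fin d → ℝ) :
    0 ≤ truncDensity 0 S a b x :=
  indicator_nonneg (fun x _ => div_nonneg (normalDensity_pos hS 0 x).le (fraction_pos hS hab).le) x

theorem measurable_truncDensity (hS : S.PosDef) : Measurable (truncDensity 0 S a b) :=
  ((gaussianDecay_normalDensity hS).1.measurable.div_const _).indicator (measurableSet_box a b)

theorem integral_truncNormal (hS : S.PosDef) (hab : ∀ k, a k < b k) (h : (Fin d → ℝ) → ℝ) :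
    ∫ x, h x ∂truncNormal 0 S a b =
      (fraction 0 S a b)⁻¹ * ∫ x in box a b, h x * normalDensity 0 S x := by
  rw [truncNormal, integral_withDensity_eq_integral_toReal_smul
    (measurable_truncDensity hS).ennreal_ofReal (by simp),
    ← integral_const_mul, ← integral_indicator (measurableSet_box a b)]
  congr 1
  ext x
  rw [ENNReal.toReal_ofReal (truncDensity_nonneg hS hab x), smul_eq_mul]
  by_cases hx : x ∈ box a b
  · rw [truncDensity_of_mem hx, indicator_of_mem hx]
    ring
  · simp [truncDensity, indicator_of_notMem hx]

theorem integrable_truncNormal (hS : S.PosDef) (hab : ∀ k, a k < b k) {h : (Fin d → ℝ) → ℝ}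
    (hh : GaussianDecay fun x => h x * normalDensity 0 S x) :
    Integrable h (truncNormal 0 S a b) := by
  rw [truncNormal, integrable_withDensity_iff_integrable_smul'
    (measurable_truncDensity hS).ennreal_ofReal (by simp)]
  refine ((hh.integrable.const_mul (fraction 0 S a b)⁻¹).indicator
    (measurableSet_box a b)).congr (Eventually.of_forall fun x => ?_)
  beta_reduce
  rw [ENNReal.toReal_ofReal (truncDensity_nonneg hS hab x), smul_eq_mul]
  by_cases hx : x ∈ box a b
  · rw [truncDensity_of_mem hx, indicator_of_mem hx]
    ring
  · simp [truncDensity, indicator_of_notMem hx]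

theorem isProbabilityMeasure_truncNormal (hS : S.PosDef) (hab : ∀ k, a k < b k) :
    IsProbabilityMeasure (truncNormal 0 S a b) := by
  have hint : Integrable (fun _ => (1 : ℝ)) (truncNormal 0 S a b) :=
    integrable_truncNormal hS hab (by simpa using gaussianDecay_normalDensity hS)
  have hfin : IsFiniteMeasure (truncNormal 0 S a b) :=
    (integrable_const_iff.1 hint).resolve_left one_ne_zero
  have h := integral_truncNormal hS hab fun _ => 1
  simp only [one_mul, integral_const, smul_eq_mul, mul_one] at h
  rw [← fraction, inv_mul_cancel₀ (fraction_pos hS hab).ne'] at h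
  exact ⟨(ENNReal.toReal_eq_one_iff _).1 h⟩

theorem memLp_coord_truncNormal (hS : S.PosDef) (hab : ∀ k, a k < b k) (i : Fin d) :
    MemLp (fun x : Fin d → ℝ => x i) 2 (truncNormal 0 S a b) := by
  rw [memLp_two_iff_integrable_sq (measurable_pi_apply i).aestronglyMeasurable]
  refine integrable_truncNormal hS hab ?_
  simpa only [sq, mul_assoc] using ((gaussianDecay_normalDensity hS).coord_mul i).coord_mul i

theorem integrable_exp_truncNormal (hS : S.PosDef) (hab : ∀ k, a k < b k) (t : Fin d → ℝ) :
    Integrable (fun x => Real.exp (t ⬝ᵥ x)) (truncNormal 0 S a b) :=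
  integrable_truncNormal hS hab ((gaussianDecay_normalDensity hS).exp_mul t)

/-! ### Partial derivatives of the moment generating function. -/

theorem hasLineDerivAt_momentGen (hS : S.PosDef) (hab : ∀ k, a k < b k) (t : Fin d → ℝ)
    (i : Fin d) :
    HasLineDerivAt ℝ (momentGen S a b) (∫ x, Real.exp (t ⬝ᵥ x) * x i ∂truncNormal 0 S a b) t
      (Pi.single i 1) := by
  have hbound : Integrable (fun x => Real.exp (2 * |x i|) * |Real.exp (t ⬝ᵥ x)|)
      (truncNormal 0 S a b) := by
    refine integrable_truncNormal hS hab ?_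
    simpa only [Real.abs_exp, mul_assoc] using
      ((gaussianDecay_normalDensity hS).exp_mul t).exp_abs_coord_mul i 2
  have h := hasDerivAt_integral_mul_exp
    (integrable_exp_truncNormal hS hab t).aestronglyMeasurable
    (measurable_pi_apply i).aestronglyMeasurable (integrable_exp_truncNormal hS hab t) hbound
  unfold HasLineDerivAt
  convert! h using 3 with s
  simp only [momentGen, add_dotProduct, smul_dotProduct, single_dotProduct, one_mul, smul_eq_mul,
    Real.exp_add]

theorem hasLineDerivAt_lineDeriv_momentGen (hS : S.PosDef) (hab : ∀ k, a k < b k) (i j : Fin d) :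
    HasLineDerivAt ℝ (fun t => lineDeriv ℝ (momentGen S a b) t (Pi.single i 1))
      (∫ x, x i * x j ∂truncNormal 0 S a b) 0 (Pi.single j 1) := by
  have hint : Integrable (fun x : Fin d → ℝ => x i) (truncNormal 0 S a b) :=
    integrable_truncNormal hS hab ((gaussianDecay_normalDensity hS).coord_mul i)
  have hbound : Integrable (fun x : Fin d → ℝ => Real.exp (2 * |x j|) * |x i|)
      (truncNormal 0 S a b) := by
    refine integrable_truncNormal hS hab ?_
    have h := ((gaussianDecay_normalDensity hS).coord_mul i).abs.exp_abs_coord_mul j 2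
    simpa only [abs_mul, abs_of_pos (normalDensity_pos hS 0 _), mul_assoc] using h
  have h := hasDerivAt_integral_mul_exp hint.aestronglyMeasurable
    (measurable_pi_apply j).aestronglyMeasurable hint hbound
  unfold HasLineDerivAt
  convert! h using 3 with s
  beta_reduce
  rw [(hasLineDerivAt_momentGen hS hab _ i).lineDeriv]
  simp [single_dotProduct, mul_comm]

/-! ### Integration by parts: box, faces, corners. -/

theorem hasDerivAt_insertCoord {ι : Type*} [Fintype ι] [DecidableEq ι] (k : ι)
    (z : {i // i ≠ k} → ℝ) (s : ℝ) :
    HasDerivAt (fun s => insertCoord k s z) (Pi.single k 1) s := by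
  refine hasDerivAt_pi.2 fun i => ?_
  by_cases h : i ≠ k
  · simpa only [insertCoord_of_ne k h, Pi.single_eq_of_ne h] using hasDerivAt_const s _
  · obtain rfl := not_ne_iff.1 h
    simpa only [insertCoord_self, Pi.single_eq_same] using hasDerivAt_id' s

theorem hasDerivAt_insertCoord_insertCoord {ι : Type*} [Fintype ι] [DecidableEq ι] {k q : ι}
    (hq : q ≠ k) (c : ℝ) (w : {i : {i // i ≠ k} // i ≠ ⟨q, hq⟩} → ℝ) (s : ℝ) :
    HasDerivAt (fun s => insertCoord k c (insertCoord ⟨q, hq⟩ s w)) (Pi.single q 1) s := by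
  refine hasDerivAt_pi.2 fun i => ?_
  by_cases h : i ≠ k
  · have h' := hasDerivAt_pi.1 (hasDerivAt_insertCoord (⟨q, hq⟩ : {i // i ≠ k}) w s) ⟨i, h⟩
    simpa only [insertCoord_of_ne k h, Pi.single_apply, Subtype.mk.injEq] using h'
  · obtain rfl := not_ne_iff.1 h
    simpa only [insertCoord_self, Pi.single_eq_of_ne hq.symm] using hasDerivAt_const s _

/-- Integrate ∂_k(x_j p) = δ_jk p - x_j (S⁻¹x)_k p over the box and solve for the last term. -/
theorem setIntegral_coord_mul_mulVec (hS : S.PosDef) (hab : ∀ k, a k < b k) (j k : Fin d) :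
    ∫ x in box a b, x j * (S⁻¹ *ᵥ x) k * normalDensity 0 S x =
      (if j = k then fraction 0 S a b else 0) +
      (endValue (fun c => ∫ z in box (fun i : {i // i ≠ k} => a i) (fun i : {i // i ≠ k} => b i),
          insertCoord k c z j * normalDensity 0 S (insertCoord k c z)) (a k) -
        endValue (fun c => ∫ z in box (fun i : {i // i ≠ k} => a i) (fun i : {i // i ≠ k} => b i),
          insertCoord k c z j * normalDensity 0 S (insertCoord k c z)) (b k)) := by
  have hp := gaussianDecay_normalDensity hS
  have h1 := hp.const_mul (if j = k then 1 else 0)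
  have h2 : GaussianDecay fun x => x j * (S⁻¹ *ᵥ x) k * normalDensity 0 S x := by
    simpa only [mul_assoc] using (hp.mulVec_mul S⁻¹ k).coord_mul j
  have h := setIntegral_box_partialDeriv k (hab k) (g := fun x => x j * normalDensity 0 S x)
    (g' := fun x => (if j = k then 1 else 0) * normalDensity 0 S x -
      x j * (S⁻¹ *ᵥ x) k * normalDensity 0 S x) (fun z s => ?_) (hp.coord_mul j) (h1.sub h2)
  · rw [integral_sub h1.integrable.integrableOn h2.integrable.integrableOn,
      integral_const_mul, ← fraction] at h
    rw [ite_mul, one_mul, zero_mul] at h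
    linarith
  · have hx := hasDerivAt_insertCoord k z s
    refine ((hasDerivAt_pi.1 hx j).mul (hasDerivAt_normalDensity_line hS hx)).congr_deriv ?_
    rw [Pi.single_apply]
    ring

/-- The coordinates other than `k` and `q`, removed one after the other or simultaneously. -/
def subtypeNeNeEquiv {ι : Type*} {k q : ι} (hq : q ≠ k) :
    {i : {i // i ≠ k} // i ≠ ⟨q, hq⟩} ≃ {i // i ≠ k ∧ i ≠ q} where
  toFun i := ⟨i.1.1, i.1.2, fun h => i.2 (Subtype.ext h)⟩
  invFun i := ⟨⟨i.1, i.2.1⟩, fun h => i.2.2 (congrArg Subtype.val h)⟩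
  left_inv _ := rfl
  right_inv _ := rfl

/-- The truncation interval is closed, so even at an endpoint c the face lies in the box and the
indicator in `truncDensity` equals 1. -/
theorem marginal_eq {k : Fin d} {c : ℝ} (hc : a k ≤ c ∧ (c : EReal) ≤ b k) :
    marginal S a b k c = (fraction 0 S a b)⁻¹ *
      ∫ z in box (fun i : {i // i ≠ k} => a i) (fun i : {i // i ≠ k} => b i),
        normalDensity 0 S (insertCoord k c z) := by
  rw [marginal, ← integral_const_mul]
  exact setIntegral_congr_fun (measurableSet_box _ _) fun z hz =>
    truncDensity_of_mem ((insertCoord_mem_box k a b c z).2 ⟨hz, hc⟩)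

theorem marginal₂_eq {k q : Fin d} (hq : q ≠ k) {c e : ℝ} (hc : a k ≤ c ∧ (c : EReal) ≤ b k)
    (he : a q ≤ e ∧ (e : EReal) ≤ b q) :
    marginal₂ S a b k q c e = (fraction 0 S a b)⁻¹ *
      ∫ w in box (fun i : {i : {i // i ≠ k} // i ≠ ⟨q, hq⟩} => a i)
        (fun i : {i : {i // i ≠ k} // i ≠ ⟨q, hq⟩} => b i),
        normalDensity 0 S (insertCoord k c (insertCoord ⟨q, hq⟩ e w)) := by
  have hmp := volume_preserving_arrowCongr' (subtypeNeNeEquiv hq) (MeasurableEquiv.refl ℝ)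
    (MeasurePreserving.id volume)
  have hpre : MeasurableEquiv.arrowCongr' (subtypeNeNeEquiv hq) (MeasurableEquiv.refl ℝ) ⁻¹'
      box (fun i : {i : Fin d // i ≠ k ∧ i ≠ q} => a i)
        (fun i : {i : Fin d // i ≠ k ∧ i ≠ q} => b i) =
      box (fun i : {i : {i // i ≠ k} // i ≠ ⟨q, hq⟩} => a i)
        (fun i : {i : {i // i ≠ k} // i ≠ ⟨q, hq⟩} => b i) := by
    ext w
    exact ⟨fun h i => h (subtypeNeNeEquiv hq i), fun h i => h ((subtypeNeNeEquiv hq).symm i)⟩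
  rw [marginal₂, ← integral_const_mul,
    ← hmp.setIntegral_preimage_emb (MeasurableEquiv.measurableEmbedding _), hpre]
  refine setIntegral_congr_fun (measurableSet_box _ _) fun w hw => ?_
  have hmem : insertCoord k c (insertCoord ⟨q, hq⟩ e w) ∈ box a b :=
    (insertCoord_mem_box k a b c _).2
      ⟨(insertCoord_mem_box (⟨q, hq⟩ : {i // i ≠ k}) (fun i => a i) (fun i => b i) e w).2
        ⟨hw, he⟩, hc⟩
  rw [← truncDensity_of_mem hmem]
  congr 1
  ext i
  by_cases hik : i = k
  · subst hik
    simp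
  · by_cases hiq : i = q
    · subst hiq
      simp [hq, insertCoord]
    · simp [hik, hiq, insertCoord]
      rfl

/-- On the face x_k = c the direction q is still free, and (S⁻¹x)_q p = -∂_q p is a pure derivative
there. -/
theorem setIntegral_face_mulVec (hS : S.PosDef) (hab : ∀ k, a k < b k) {k q : Fin d} (hq : q ≠ k)
    {c : ℝ} (hc : a k ≤ c ∧ (c : EReal) ≤ b k) :
    (fraction 0 S a b)⁻¹ *
      ∫ z in box (fun i : {i // i ≠ k} => a i) (fun i : {i // i ≠ k} => b i),
        (S⁻¹ *ᵥ insertCoord k c z) q * normalDensity 0 S (insertCoord k c z) =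
      cornerMarginal S a b k q c (a q) - cornerMarginal S a b k q c (b q) := by
  have hp := gaussianDecay_normalDensity hS
  have h := setIntegral_box_partialDeriv (⟨q, hq⟩ : {i // i ≠ k})
    (a := fun i => a i) (b := fun i => b i) (hab q)
    (g := fun z => normalDensity 0 S (insertCoord k c z))
    (g' := fun z => -((S⁻¹ *ᵥ insertCoord k c z) q * normalDensity 0 S (insertCoord k c z)))
    (fun w s => hasDerivAt_normalDensity_line hS (hasDerivAt_insertCoord_insertCoord hq c w s))
    (hp.insertCoord k c)
    (by simpa using ((hp.mulVec_mul S⁻¹ q).insertCoord k c).const_mul (-1))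
  rw [integral_neg] at h
  have hcorner : ∀ e : EReal, (a q ≤ e ∧ e ≤ b q) →
      cornerMarginal S a b k q c e = (fraction 0 S a b)⁻¹ *
        endValue (fun s => ∫ w in box (fun i : {i : {i // i ≠ k} // i ≠ ⟨q, hq⟩} => a i)
          (fun i : {i : {i // i ≠ k} // i ≠ ⟨q, hq⟩} => b i),
          normalDensity 0 S (insertCoord k c (insertCoord ⟨q, hq⟩ s w))) e := by
    intro e he
    unfold cornerMarginal endValue
    simp only [EReal.coe_ne_bot, EReal.coe_ne_top, or_self, false_or, EReal.toReal_coe]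
    split_ifs with hinf
    · simp
    · push Not at hinf
      rw [marginal₂_eq hq hc (by rwa [EReal.coe_toReal hinf.2 hinf.1])]
  rw [hcorner _ ⟨le_rfl, (hab q).le⟩, hcorner _ ⟨(hab q).le, le_rfl⟩, ← mul_sub]
  congr 1
  linarith

theorem mulVec_inv_mulVec_apply (hS : S.PosDef) (x : Fin d → ℝ) (i : Fin d) :
    ∑ k, S i k * (S⁻¹ *ᵥ x) k = x i := by
  have h : S *ᵥ (S⁻¹ *ᵥ x) = x := by
    rw [Matrix.mulVec_mulVec, Matrix.mul_nonsing_inv _ hS.det_pos.ne'.isUnit, Matrix.one_mulVec]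
  exact congrFun h i

/-- Regression of the coordinate `j` on the coordinate `k`, in terms of the score function. -/
theorem coord_eq_regression_add (hS : S.PosDef) (x : Fin d → ℝ) (j k : Fin d) :
    x j = S j k / S k k * x k +
      ∑ q ∈ Finset.univ.erase k, (S j q - S k q * S j k / S k k) * (S⁻¹ *ᵥ x) q := by
  have hkk : S k k ≠ 0 := hS.diag_pos.ne'
  -- The coefficient at q = k vanishes, so the sum may run over all q, and S S⁻¹ x = x evaluates it
  -- as x_j - (S j k / S k k) x_k.
  have hk : (S j k - S k k * S j k / S k k) * (S⁻¹ *ᵥ x) k = 0 := by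
    field_simp
    simp
  rw [Finset.sum_erase (f := fun q => (S j q - S k q * S j k / S k k) * (S⁻¹ *ᵥ x) q) _ hk]
  have hterm : ∀ q, (S j q - S k q * S j k / S k k) * (S⁻¹ *ᵥ x) q =
      S j q * (S⁻¹ *ᵥ x) q - S j k / S k k * (S k q * (S⁻¹ *ᵥ x) q) := fun q => by ring
  simp only [hterm, Finset.sum_sub_distrib, ← Finset.mul_sum, mulVec_inv_mulVec_apply hS]
  ring

/-- In the regression of x_j on x_k, the first term is constant on the face and yields
`endMarginal`; the remaining scores integrate to corners. At infinite c all terms are 0 by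
convention. -/
theorem endValue_face_coord (hS : S.PosDef) (hab : ∀ k, a k < b k) (j k : Fin d) {c : EReal}
    (hc : a k ≤ c ∧ c ≤ b k) :
    (fraction 0 S a b)⁻¹ *
      endValue (fun c => ∫ z in box (fun i : {i // i ≠ k} => a i) (fun i : {i // i ≠ k} => b i),
        insertCoord k c z j * normalDensity 0 S (insertCoord k c z)) c =
      S j k / S k k * endMarginal S a b k c +
        ∑ q ∈ Finset.univ.erase k, (S j q - S k q * S j k / S k k) *
          (cornerMarginal S a b k q c (a q) - cornerMarginal S a b k q c (b q)) := by
  by_cases hinf : c = ⊥ ∨ c = ⊤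
  · simp [endValue, endMarginal, cornerMarginal, hinf]
  · have hcr : ((c.toReal : ℝ) : EReal) = c := by
      push Not at hinf
      exact EReal.coe_toReal hinf.2 hinf.1
    simp only [endValue, endMarginal, hinf, if_false]
    generalize c.toReal = r at *
    subst hcr
    have hp := gaussianDecay_normalDensity hS
    rw [marginal_eq hc]
    have hpt : ∀ z, insertCoord k r z j * normalDensity 0 S (insertCoord k r z) =
        S j k / S k k * r * normalDensity 0 S (insertCoord k r z) +
          ∑ q ∈ Finset.univ.erase k, (S j q - S k q * S j k / S k k) *
            ((S⁻¹ *ᵥ insertCoord k r z) q * normalDensity 0 S (insertCoord k r z)) := fun z => by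
      conv_lhs => rw [coord_eq_regression_add hS (insertCoord k r z) j k, insertCoord_self]
      rw [add_mul, Finset.sum_mul]
      simp only [mul_assoc]
    have hq : ∀ q, GaussianDecay fun z => (S j q - S k q * S j k / S k k) *
        ((S⁻¹ *ᵥ insertCoord k r z) q * normalDensity 0 S (insertCoord k r z)) := fun q =>
      ((hp.mulVec_mul S⁻¹ q).insertCoord k r).const_mul _
    simp only [hpt]
    rw [integral_add ((hp.insertCoord k r).const_mul _).integrable.integrableOn
      (GaussianDecay.sum hq _).integrable.integrableOn,
      integral_finsetSum _ fun q _ => (hq q).integrable.integrableOn, mul_add, Finset.mul_sum]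
    congr 1
    · rw [integral_const_mul]
      ring
    · refine Finset.sum_congr rfl fun q hqk => ?_
      rw [integral_const_mul, ← setIntegral_face_mulVec hS hab (Finset.ne_of_mem_erase hqk) hc]
      ring

theorem integral_coord_mul_coord (hS : S.PosDef) (hab : ∀ k, a k < b k) (i j : Fin d) :
    ∫ x, x i * x j ∂truncNormal 0 S a b =
      S i j + ∑ k, S i k * (S j k * (endMarginal S a b k (a k) - endMarginal S a b k (b k)) / S k k)
      + ∑ k, S i k * ∑ q ∈ Finset.univ.erase k, (S j q - S k q * S j k / S k k) *
          ((cornerMarginal S a b k q (a k) (a q) - cornerMarginal S a b k q (a k) (b q))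
            - (cornerMarginal S a b k q (b k) (a q) - cornerMarginal S a b k q (b k) (b q))) := by
  have hα := (fraction_pos hS hab).ne'
  have hp := gaussianDecay_normalDensity hS
  have hpt : ∀ x : Fin d → ℝ, x i * x j * normalDensity 0 S x =
      ∑ k, S i k * (x j * (S⁻¹ *ᵥ x) k * normalDensity 0 S x) := fun x => by
    conv_lhs => rw [← mulVec_inv_mulVec_apply hS x i, Finset.sum_mul, Finset.sum_mul]
    exact Finset.sum_congr rfl fun k _ => by ring
  have hk : ∀ k, GaussianDecay fun x => S i k * (x j * (S⁻¹ *ᵥ x) k * normalDensity 0 S x) :=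
    fun k => by
      simpa only [mul_assoc] using ((hp.mulVec_mul S⁻¹ k).coord_mul j).const_mul (S i k)
  -- S i j is spread over k to match the δ_jk left by each integration by parts, so that the
  -- identity can be checked for each k separately.
  have hsum : S i j = ∑ k, S i k * if j = k then 1 else 0 := by simp
  rw [integral_truncNormal hS hab]
  simp only [hpt]
  rw [integral_finsetSum _ fun k _ => (hk k).integrable.integrableOn, Finset.mul_sum]
  conv_rhs => rw [hsum]
  rw [← Finset.sum_add_distrib, ← Finset.sum_add_distrib]
  refine Finset.sum_congr rfl fun k _ => ?_
  rw [integral_const_mul, setIntegral_coord_mul_mulVec hS hab, mul_left_comm, mul_add, mul_sub,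
    endValue_face_coord hS hab j k ⟨le_rfl, (hab k).le⟩,
    endValue_face_coord hS hab j k ⟨(hab k).le, le_rfl⟩, mul_ite, mul_zero, inv_mul_cancel₀ hα]
  simp only [mul_sub (_ - _) (_ - _) (_ - _), Finset.sum_sub_distrib]
  ring

/-! ### Shift of location. -/

theorem mem_box_add_iff (μ y : Fin d → ℝ) :
    y ∈ box (fun k => a k + (μ k : EReal)) (fun k => b k + (μ k : EReal)) ↔ y - μ ∈ box a b := by
  refine forall_congr' fun k => ?_
  rw [Pi.sub_apply, EReal.coe_sub,
    EReal.le_sub_iff_add_le (.inl (EReal.coe_ne_bot _)) (.inl (EReal.coe_ne_top _)),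
    EReal.sub_le_iff_le_add (.inl (EReal.coe_ne_bot _)) (.inl (EReal.coe_ne_top _))]

theorem normalDensity_eq_sub (μ y : Fin d → ℝ) :
    normalDensity μ S y = normalDensity 0 S (y - μ) := by
  simp [normalDensity]

theorem fraction_add (μ : Fin d → ℝ) :
    fraction μ S (fun k => a k + (μ k : EReal)) (fun k => b k + (μ k : EReal)) =
      fraction 0 S a b := by
  have hpre : box (fun k => a k + (μ k : EReal)) (fun k => b k + (μ k : EReal)) =
      (fun y => y - μ) ⁻¹' box a b := by
    ext y
    exact mem_box_add_iff μ y
  have h := (measurePreserving_sub_right volume μ).setIntegral_preimage_emb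
    (MeasurableEquiv.subRight μ).measurableEmbedding (normalDensity 0 S) (box a b)
  rw [fraction, fraction, hpre, ← h]
  simp only [normalDensity_eq_sub μ]

theorem truncDensity_add (μ y : Fin d → ℝ) :
    truncDensity μ S (fun k => a k + (μ k : EReal)) (fun k => b k + (μ k : EReal)) y =
      truncDensity 0 S a b (y - μ) := by
  by_cases hy : y - μ ∈ box a b
  · rw [truncDensity, truncDensity, indicator_of_mem hy,
      indicator_of_mem ((mem_box_add_iff μ y).2 hy), fraction_add, normalDensity_eq_sub]
  · rw [truncDensity, truncDensity, indicator_of_notMem hy,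
      indicator_of_notMem (mt (mem_box_add_iff μ y).1 hy)]

theorem map_truncNormal_add (μ : Fin d → ℝ) :
    (truncNormal μ S (fun k => a k + (μ k : EReal)) (fun k => b k + (μ k : EReal))).map
      (fun y => y - μ) = truncNormal 0 S a b := by
  ext s hs
  have hm : Measurable fun y : Fin d → ℝ => y - μ := measurable_sub_const μ
  have h := (measurePreserving_sub_right volume μ).setLIntegral_comp_preimage_emb
    (MeasurableEquiv.subRight μ).measurableEmbedding
    (fun x => ENNReal.ofReal (truncDensity 0 S a b x)) s
  rw [Measure.map_apply hm hs, truncNormal, truncNormal, withDensity_apply _ (hm hs),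
    withDensity_apply _ hs, ← h]
  simp only [truncDensity_add]

/-- As a pushforward of the centered law, the shifted law inherits total mass, square integrability
and covariances. -/
theorem truncNormal_add_eq_map (μ : Fin d → ℝ) :
    truncNormal μ S (fun k => a k + (μ k : EReal)) (fun k => b k + (μ k : EReal)) =
      (truncNormal 0 S a b).map fun x => x + μ := by
  rw [← map_truncNormal_add μ, Measure.map_map (measurable_add_const μ) (measurable_sub_const μ)]
  simp [Function.comp_def]

end TruncNormal

theorem mainTheorem2 (d : ℕ) (S : Matrix (Fin d) (Fin d) ℝ) (hS : S.PosDef)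
    (a b : Fin d → EReal) (hab : ∀ k, a k < b k) :
    -- the centered truncated normal distribution and its moments
    IsProbabilityMeasure (TruncNormal.truncNormal 0 S a b) ∧
    (∀ i, MemLp (fun x : Fin d → ℝ => x i) 2 (TruncNormal.truncNormal 0 S a b)) ∧
    (∀ t : Fin d → ℝ,
      Integrable (fun x => Real.exp (t ⬝ᵥ x)) (TruncNormal.truncNormal 0 S a b)) ∧
    (∀ i j : Fin d,
      -- the second moment is the second partial derivative of the m.g.f. at the origin
      (∀ t, LineDifferentiableAt ℝ (TruncNormal.momentGen S a b) t (Pi.single i 1)) ∧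
      HasLineDerivAt ℝ
        (fun t => lineDeriv ℝ (TruncNormal.momentGen S a b) t (Pi.single i 1))
        (∫ x, x i * x j ∂(TruncNormal.truncNormal 0 S a b)) 0 (Pi.single j 1) ∧
      -- the explicit formula
      ∫ x, x i * x j ∂(TruncNormal.truncNormal 0 S a b) =
        S i j
        + ∑ k, S i k * (S j k * (TruncNormal.endMarginal S a b k (a k)
            - TruncNormal.endMarginal S a b k (b k)) / S k k)
        + ∑ k, S i k * ∑ q ∈ Finset.univ.erase k, (S j q - S k q * S j k / S k k) *
            ((TruncNormal.cornerMarginal S a b k q (a k) (a q)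
                - TruncNormal.cornerMarginal S a b k q (a k) (b q))
              - (TruncNormal.cornerMarginal S a b k q (b k) (a q)
                - TruncNormal.cornerMarginal S a b k q (b k) (b q)))) ∧
    -- general location `μ`: the truncation points are shifted by `μ`
    (∀ μ : Fin d → ℝ,
      IsProbabilityMeasure (TruncNormal.truncNormal μ S (fun k => a k + (μ k : EReal))
        (fun k => b k + (μ k : EReal))) ∧
      (∀ i, MemLp (fun y : Fin d → ℝ => y i) 2 (TruncNormal.truncNormal μ S
        (fun k => a k + (μ k : EReal)) (fun k => b k + (μ k : EReal)))) ∧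
      (TruncNormal.truncNormal μ S (fun k => a k + (μ k : EReal))
        (fun k => b k + (μ k : EReal))).map (fun y => y - μ) = TruncNormal.truncNormal 0 S a b ∧
      ∀ i j : Fin d,
        cov[fun y => y i, fun y => y j; TruncNormal.truncNormal μ S
            (fun k => a k + (μ k : EReal)) (fun k => b k + (μ k : EReal))]
          = cov[fun x => x i, fun x => x j; TruncNormal.truncNormal 0 S a b] ∧
        cov[fun x => x i, fun x => x j; TruncNormal.truncNormal 0 S a b]
          = ∫ x, x i * x j ∂(TruncNormal.truncNormal 0 S a b)
            - (∫ x, x i ∂(TruncNormal.truncNormal 0 S a b))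
              * ∫ x, x j ∂(TruncNormal.truncNormal 0 S a b)) := by
  have hP := TruncNormal.isProbabilityMeasure_truncNormal hS hab
  have hL := TruncNormal.memLp_coord_truncNormal hS hab
  refine ⟨hP, hL, TruncNormal.integrable_exp_truncNormal hS hab, fun i j =>
    ⟨fun t => (TruncNormal.hasLineDerivAt_momentGen hS hab t i).lineDifferentiableAt,
      TruncNormal.hasLineDerivAt_lineDeriv_momentGen hS hab i j,
      TruncNormal.integral_coord_mul_coord hS hab i j⟩, fun μ => ?_⟩
  have hm : Measurable fun x : Fin d → ℝ => x + μ := measurable_add_const μ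
  have hc : ∀ i, Measurable fun x : Fin d → ℝ => x i := measurable_pi_apply
  refine ⟨?_, fun i => ?_, TruncNormal.map_truncNormal_add μ, fun i j => ⟨?_, ?_⟩⟩
  · rw [TruncNormal.truncNormal_add_eq_map]
    exact Measure.isProbabilityMeasure_map hm.aemeasurable
  · rw [TruncNormal.truncNormal_add_eq_map,
      memLp_map_measure_iff (hc i).aestronglyMeasurable hm.aemeasurable]
    exact (hL i).add (memLp_const (μ i))
  · rw [TruncNormal.truncNormal_add_eq_map, covariance_map_fun (hc i).aestronglyMeasurable
      (hc j).aestronglyMeasurable hm.aemeasurable]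
    simp only [Pi.add_apply]
    rw [covariance_add_const_left ((hL i).integrable one_le_two),
      covariance_add_const_right ((hL j).integrable one_le_two)]
  · exact covariance_eq_sub (hL i) (hL j)
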